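/- Let $\Gamma$ be a countable discrete group with identity $e$. Cohomology. $Z^2(\Gamma,\mathbb R)$ is the space of functions $\sigma:\Gamma^2\to\mathbb R$ with $\sigma(a,b)+\sigma(ab,c)=\sigma(a,bc)+\sigma(b,c)$ for all $a,b,c\in\Gamma$; for $\gamma:\Gamma\to\mathbb R$ put $\partial\gamma(a,b)=\gamma(a)-\gamma(ab)+\gamma(b)$; and $H^2(\Gamma,\mathbb R)=Z^2(\Gamma,\mathbb R)/\{\partial\gamma\}$. $H^2_b(\Gamma,\mathbb R)$ is the quotient of the bounded 2-cocycles by the coboundaries $\partial\gamma$ of bounded functions $\gamma$, and the comparison map $J:H^2_b(\Gamma,\mathbb R)\to H^2(\Gamma,\mathbb R)$ is induced by inclusion. A 2-cocycle is normalized if $\sigma(a,e)=\sigma(e,a)=0$ for all $a$. Stability. Let $\mathcal B$ be the class of separable unital C*-algebras that admit a tracial state. $\Gamma$ is local-to-local (respectively uniform-to-local) stable with respect to $\mathcal B$ if for every sequence of unital maps $\rho_n:\Gamma\to U(B_n)$, $B_n\in\mathcal B$, with $\lim_n\|\rho_n(st)-\rho_n(s)\rho_n(t)\|=0$ for all $s,t\in\Gamma$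 (respectively $\lim_n\sup_{s,t\in\Gamma}\|\rho_n(st)-\rho_n(s)\rho_n(t)\|=0$) there are group homomorphisms $\pi_n:\Gamma\to U(B_n)$ with $\lim_n\|\rho_n(s)-\pi_n(s)\|=0$ for all $s\in\Gamma$. Twisted algebras. For a normalized 2-cocycle $\sigma\in Z^2(\Gamma,\mathbb R)$ and $n\ge1$ put $\omega_n=e^{2\pi i\sigma/n}$, let $\rho_n(s)$ be the unitary operator on $\ell^2(\Gamma)$ with $\rho_n(s)\delta_t=\omega_n(s,t)\delta_{st}$, and let $C^*_r(\Gamma,\omega_n)\subset B(\ell^2(\Gamma))$ be the C*-algebra generated by the operators $\rho_n(s)$, $s\in\Gamma$. Theorem. (1) If $H^2(\Gamma,\mathbb R)\ne0$, then $\Gamma$ is not local-to-local stable with respect to $\mathcal B$. (2) If $J:H^2_b(\Gamma,\mathbb R)\to H^2(\Gamma,\mathbb R)$ is nonzero, then $\Gamma$ is not uniform-to-local stable with respect to $\mathcal B$. (3) Witnesses: let $\sigma$ be a normalized 2-cocycle with $[\sigma]\neq0$ in $H^2(\Gamma,\mathbb R)$. Then $C^*_r(\Gamma,\omega_n)\in\mathcal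 B$ for all $n\ge1$; the maps $\rho_n:\Gamma\to U(C^*_r(\Gamma,\omega_n))$ are unital and satisfy $\rho_n(s)\rho_n(t)=e^{2\pi i\sigma(s,t)/n}\rho_n(st)$; $\lim_n\|\rho_n(st)-\rho_n(s)\rho_n(t)\|=0$ for all $s,t\in\Gamma$, and $\lim_n\sup_{s,t\in\Gamma}\|\rho_n(st)-\rho_n(s)\rho_n(t)\|=0$ if $\sigma$ is bounded; and there is no sequence of group homomorphisms $\pi_n:\Gamma\to GL(C^*_r(\Gamma,\omega_n))$ (in particular none into the unitary groups) with $\lim_n\|\rho_n(s)-\pi_n(s)\|=0$ for all $s\in\Gamma$. -/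

import Mathlib

open Filter Topology

universe u v

noncomputable section

/-! ### Second (bounded) group cohomology with trivial real coefficients -/

section Cohomology

variable (Γ : Type u) [Group Γ]

/-- The coboundary `(∂γ)(a, b) = γ(a) - γ(ab) + γ(b)` of a function `γ : Γ → ℝ`. -/
def coboundaryMap : (Γ → ℝ) →ₗ[ℝ] (Γ → Γ → ℝ) where
  toFun γ := fun a b => γ a - γ (a * b) + γ b
  map_add' γ γ' := by
    funext a b
    simp only [Pi.add_apply]
    ring
  map_smul' r γ := by
    funext a b
    simp only [Pi.smul_apply, smul_eq_mul, RingHom.id_apply]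
    ring

/-- `Z²(Γ, ℝ)`: functions `σ : Γ² → ℝ` with `σ(a,b) + σ(ab,c) = σ(a,bc) + σ(b,c)`. -/
def twoCocycles : Submodule ℝ (Γ → Γ → ℝ) where
  carrier := {σ | ∀ a b c, σ a b + σ (a * b) c = σ a (b * c) + σ b c}
  zero_mem' := by
    intro a b c
    simp
  add_mem' := by
    intro σ σ' h h' a b c
    simp only [Pi.add_apply]
    linarith [h a b c, h' a b c]
  smul_mem' := by
    intro r σ h a b c
    simp only [Pi.smul_apply, smul_eq_mul, ← mul_add, h a b c]

/-- `B²(Γ, ℝ)`: the coboundaries of arbitrary functions `Γ → ℝ`. -/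
def twoCoboundaries : Submodule ℝ (Γ → Γ → ℝ) :=
  LinearMap.range (coboundaryMap Γ)

/-- `H²(Γ, ℝ) = Z²(Γ, ℝ) / B²(Γ, ℝ)`. -/
abbrev SecondCohomology : Type u :=
  twoCocycles Γ ⧸ (twoCoboundaries Γ).submoduleOf (twoCocycles Γ)

/-- The cohomology class `[σ] ∈ H²(Γ, ℝ)` of a 2-cocycle. -/
def cohomologyClass : twoCocycles Γ →ₗ[ℝ] SecondCohomology Γ :=
  ((twoCoboundaries Γ).submoduleOf (twoCocycles Γ)).mkQ

/-- The bounded functions `Γ → ℝ`. -/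
def boundedOneCochains : Submodule ℝ (Γ → ℝ) where
  carrier := {γ | ∃ C : ℝ, ∀ a, |γ a| ≤ C}
  zero_mem' := ⟨0, by simp⟩
  add_mem' := by
    rintro γ γ' ⟨C, hC⟩ ⟨C', hC'⟩
    exact ⟨C + C', fun a => (abs_add_le _ _).trans (add_le_add (hC a) (hC' a))⟩
  smul_mem' := by
    rintro r γ ⟨C, hC⟩
    refine ⟨|r| * C, fun a => ?_⟩
    simp only [Pi.smul_apply, smul_eq_mul, abs_mul]
    exact mul_le_mul_of_nonneg_left (hC a) (abs_nonneg r)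

/-- The bounded functions `Γ² → ℝ`. -/
def boundedTwoCochains : Submodule ℝ (Γ → Γ → ℝ) where
  carrier := {σ | ∃ C : ℝ, ∀ a b, |σ a b| ≤ C}
  zero_mem' := ⟨0, by simp⟩
  add_mem' := by
    rintro σ σ' ⟨C, hC⟩ ⟨C', hC'⟩
    exact ⟨C + C', fun a b => (abs_add_le _ _).trans (add_le_add (hC a b) (hC' a b))⟩
  smul_mem' := by
    rintro r σ ⟨C, hC⟩
    refine ⟨|r| * C, fun a b => ?_⟩
    simp only [Pi.smul_apply, smul_eq_mul, abs_mul]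
    exact mul_le_mul_of_nonneg_left (hC a b) (abs_nonneg r)

/-- Bounded 2-cocycles. -/
def boundedTwoCocycles : Submodule ℝ (Γ → Γ → ℝ) :=
  twoCocycles Γ ⊓ boundedTwoCochains Γ

/-- Coboundaries of bounded functions `Γ → ℝ`. -/
def boundedTwoCoboundaries : Submodule ℝ (Γ → Γ → ℝ) :=
  (boundedOneCochains Γ).map (coboundaryMap Γ)

/-- `H²_b(Γ, ℝ)`: bounded 2-cocycles modulo coboundaries of bounded functions. -/
abbrev SecondBoundedCohomology : Type u :=
  boundedTwoCocycles Γ ⧸ (boundedTwoCoboundaries Γ).submoduleOf (boundedTwoCocycles Γ)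

/-- The comparison map `J : H²_b(Γ, ℝ) → H²(Γ, ℝ)`, induced by the inclusion of bounded 2-cocycles
into all 2-cocycles. -/
def comparisonMap : SecondBoundedCohomology Γ →ₗ[ℝ] SecondCohomology Γ :=
  Submodule.mapQ _ _ (Submodule.inclusion (inf_le_left : boundedTwoCocycles Γ ≤ twoCocycles Γ))
    (by
      rintro ⟨σ, hσ⟩ ⟨γ, _, hγ⟩
      exact ⟨γ, hγ⟩)

end Cohomology

/-! ### Stability of groups with respect to a class of C*-algebras -/

section Stability

variable {Γ : Type u} [Group Γ]

/-- `‖ρₙ(st) - ρₙ(s)ρₙ(t)‖ → 0` for all `s, t`. -/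
def IsAsymptoticHom {B : ℕ → Type v} [∀ n, CStarAlgebra (B n)]
    (ρ : ∀ n, Γ → unitary (B n)) : Prop :=
  ∀ s t : Γ, Tendsto
    (fun n => ‖(ρ n (s * t) : B n) - (ρ n s : B n) * (ρ n t : B n)‖) atTop (𝓝 0)

/-- `sup_{s,t} ‖ρₙ(st) - ρₙ(s)ρₙ(t)‖ → 0`. The supremum is over a nonempty set of reals bounded
by `2`, since all the values of `ρₙ` are unitary. -/
def IsUniformAsymptoticHom {B : ℕ → Type v} [∀ n, CStarAlgebra (B n)]
    (ρ : ∀ n, Γ → unitary (B n)) : Prop :=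
  Tendsto
    (fun n => ⨆ p : Γ × Γ,
      ‖(ρ n (p.1 * p.2) : B n) - (ρ n p.1 : B n) * (ρ n p.2 : B n)‖) atTop (𝓝 0)

variable (Γ)

/-- Local-to-local stability with respect to a class `𝓑` of unital C*-algebras. -/
def IsLocalToLocalStable (𝓑 : ∀ (A : Type v) [CStarAlgebra A], Prop) : Prop :=
  ∀ (B : ℕ → Type v) [∀ n, CStarAlgebra (B n)], (∀ n, 𝓑 (B n)) →
    ∀ ρ : ∀ n, Γ → unitary (B n), (∀ n, ρ n 1 = 1) → IsAsymptoticHom ρ →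
      ∃ π : ∀ n, Γ →* unitary (B n), ∀ s : Γ,
        Tendsto (fun n => ‖(ρ n s : B n) - (π n s : B n)‖) atTop (𝓝 0)

/-- Uniform-to-local stability with respect to a class `𝓑` of unital C*-algebras. -/
def IsUniformToLocalStable (𝓑 : ∀ (A : Type v) [CStarAlgebra A], Prop) : Prop :=
  ∀ (B : ℕ → Type v) [∀ n, CStarAlgebra (B n)], (∀ n, 𝓑 (B n)) →
    ∀ ρ : ∀ n, Γ → unitary (B n), (∀ n, ρ n 1 = 1) → IsUniformAsymptoticHom ρ →
      ∃ π : ∀ n, Γ →* unitary (B n), ∀ s : Γ,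
        Tendsto (fun n => ‖(ρ n s : B n) - (π n s : B n)‖) atTop (𝓝 0)

end Stability

/-- `τ` is a tracial state on the unital C*-algebra `A`: a positive linear functional with
`τ(1) = 1` and `τ(xy) = τ(yx)`. -/
structure IsTracialState {A : Type v} [CStarAlgebra A] (τ : A →ₗ[ℂ] ℂ) : Prop where
  map_one : τ 1 = 1
  nonneg : ∀ a : A, ∃ r : ℝ, 0 ≤ r ∧ τ (star a * a) = (r : ℂ)
  tracial : ∀ a b : A, τ (a * b) = τ (b * a)

/-- The class of separable unital C*-algebras that have a tracial state. -/
def IsSeparableTracial (A : Type v) [CStarAlgebra A] : Prop :=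
  TopologicalSpace.SeparableSpace A ∧ ∃ τ : A →ₗ[ℂ] ℂ, IsTracialState τ

/-! ### Reduced twisted group C*-algebras -/

section Twisted

variable {Γ : Type u}

/-- The Hilbert space `ℓ²(Γ)`. -/
abbrev EllTwo (Γ : Type u) : Type u := lp (fun _ : Γ => ℂ) 2

lemma memlp_weighted (c : Γ → Circle) (e : Γ ≃ Γ) (f : EllTwo Γ) :
    Memℓp (fun r => (c r : ℂ) * f (e r)) 2 := by
  have h2 : 0 < (2 : ENNReal).toReal := by norm_num
  rw [memℓp_gen_iff h2]
  have hf := (memℓp_gen_iff h2).1 f.2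
  simpa only [norm_mul, Circle.norm_coe, one_mul, Function.comp_def] using e.summable_iff.2 hf

/-- The operator `f ↦ (r ↦ c(r) f(e(r)))` on `ℓ²(Γ)`, for a bijection `e` of `Γ` and a
function `c` with values in the unit circle. -/
def weightedComp (c : Γ → Circle) (e : Γ ≃ Γ) : EllTwo Γ →ₗ[ℂ] EllTwo Γ where
  toFun f := ⟨fun r => (c r : ℂ) * f (e r), memlp_weighted c e f⟩
  map_add' f g := by
    ext r
    exact mul_add _ _ _
  map_smul' z f := by
    ext r
    exact mul_left_comm _ _ _

@[simp] lemma weightedComp_apply (c : Γ → Circle) (e : Γ ≃ Γ) (f : EllTwo Γ) (r : Γ) :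
    weightedComp c e f r = (c r : ℂ) * f (e r) := rfl

variable [Group Γ]

/-- For `ω : Γ² → 𝕋` and `s ∈ Γ`, the unitary operator `λ_ω(s)` of `ℓ²(Γ)` with
`λ_ω(s) δ_t = ω(s,t) δ_{st}`, i.e. `(λ_ω(s) f)(r) = ω(s, s⁻¹r) f(s⁻¹r)`. -/
def twistedTranslation (ω : Γ → Γ → Circle) (s : Γ) : EllTwo Γ ≃ₗᵢ[ℂ] EllTwo Γ where
  toLinearEquiv := LinearEquiv.ofLinearMap
    (weightedComp (fun r => ω s (s⁻¹ * r)) (Equiv.mulLeft s⁻¹))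
    (weightedComp (fun t => (ω s t)⁻¹) (Equiv.mulLeft s))
    (by ext; simp [← mul_assoc])
    (by ext; simp [← mul_assoc])
  norm_map' f := by
    have h2 : 0 < (2 : ENNReal).toReal := by norm_num
    rw [lp.norm_eq_tsum_rpow h2, lp.norm_eq_tsum_rpow h2]
    congr 1
    have h : ∀ r : Γ, ‖weightedComp (fun r => ω s (s⁻¹ * r)) (Equiv.mulLeft s⁻¹) f r‖ =
        ‖f (Equiv.mulLeft s⁻¹ r)‖ := fun r => by
      rw [weightedComp_apply, norm_mul, Circle.norm_coe, one_mul]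
    exact (tsum_congr fun r => by rw [← h r]; rfl).trans
      ((Equiv.mulLeft s⁻¹).tsum_eq (fun t => ‖f t‖ ^ (2 : ENNReal).toReal))

/-- `λ_ω(s)` as a unitary element of `B(ℓ²(Γ))`. -/
def twistedUnitary (ω : Γ → Γ → Circle) (s : Γ) : unitary (EllTwo Γ →L[ℂ] EllTwo Γ) :=
  Unitary.linearIsometryEquiv.symm (twistedTranslation ω s)

/-- The reduced twisted group C*-algebra `C*_r(Γ, ω)`: the norm closed unital *-subalgebra
of `B(ℓ²(Γ))` generated by the operators `λ_ω(s)`, `s ∈ Γ`. -/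
def reducedTwisted (ω : Γ → Γ → Circle) : StarSubalgebra ℂ (EllTwo Γ →L[ℂ] EllTwo Γ) :=
  (StarAlgebra.adjoin ℂ
    (Set.range fun s => (twistedUnitary ω s : EllTwo Γ →L[ℂ] EllTwo Γ))).topologicalClosure

instance reducedTwisted.instCStarAlgebra (ω : Γ → Γ → Circle) :
    CStarAlgebra (reducedTwisted ω) :=
  StarSubalgebra.cstarAlgebra _ (h_closed := StarSubalgebra.isClosed_topologicalClosure _)

lemma twistedUnitary_mem (ω : Γ → Γ → Circle) (s : Γ) :
    (twistedUnitary ω s : EllTwo Γ →L[ℂ] EllTwo Γ) ∈ reducedTwisted ω :=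
  StarSubalgebra.le_topologicalClosure _ (StarAlgebra.subset_adjoin ℂ _ ⟨s, rfl⟩)

/-- The canonical map `Γ → U(C*_r(Γ, ω))`, `s ↦ λ_ω(s)`. -/
def canonicalRep (ω : Γ → Γ → Circle) (s : Γ) : unitary (reducedTwisted ω) :=
  ⟨⟨twistedUnitary ω s, twistedUnitary_mem ω s⟩,
    Unitary.mem_iff.2 ⟨Subtype.ext (Unitary.coe_star_mul_self (twistedUnitary ω s)),
      Subtype.ext (Unitary.coe_mul_star_self (twistedUnitary ω s))⟩⟩

/-- The circle-valued function `e^{2πiθσ}` attached to `σ : Γ² → ℝ` and `θ ∈ ℝ`. -/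
def expCocycle (θ : ℝ) (σ : Γ → Γ → ℝ) : Γ → Γ → Circle :=
  fun s t => Circle.exp (2 * Real.pi * (θ * σ s t))

/-- The algebras `C*_r(Γ, e^{2πiσ/m})`, `m ≥ 1`, listed as `m = n + 1`, `n ∈ ℕ`. -/
abbrev twistedAlgebra (σ : Γ → Γ → ℝ) (n : ℕ) : StarSubalgebra ℂ (EllTwo Γ →L[ℂ] EllTwo Γ) :=
  reducedTwisted (expCocycle (1 / ((n : ℝ) + 1)) σ)

/-- The canonical projective representations `Γ → U(C*_r(Γ, e^{2πiσ/m}))`, `m = n + 1`. -/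
def projectiveRep (σ : Γ → Γ → ℝ) (n : ℕ) : Γ → unitary (twistedAlgebra σ n) :=
  canonicalRep (expCocycle (1 / ((n : ℝ) + 1)) σ)

end Twisted

end

/-!
Suppose that projective unitary representations `ρₙ` with multipliers `exp(2πiσ/(n + 1))`, in
C*-algebras with traces `τₙ`, are asymptotically close to genuine homomorphisms `πₙ` into the
invertible elements. The elements `xₙ(s) = πₙ(s)ρₙ(s)*` tend to `1`, and
`ρₙ(s)* xₙ(st) ρₙ(s) = exp(2πiσ(s, t)/(n + 1)) · ρₙ(s)* xₙ(s) ρₙ(s) · xₙ(t)`.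
Near `1` the function `τₙ ∘ log` is invariant under conjugation and additive on products
(`traceLog_conj`, `traceLog_mul`; additivity holds because the derivative of `τ(log a)` in
the direction `v` is `τ(a⁻¹v)`). Hence `2πiσ(s, t)/(n + 1)` is a combination of the values of
`τₙ(log xₙ)` at `st`, `s`, `t`: for each pair `(s, t)` the equation `σ = ∂γₙ` holds at `(s, t)` for
all large `n`, where `γₙ = -(n + 1)/(2π) · Im τₙ(log xₙ)`.

The `γₙ` need not converge, but on each finite set of pairs `σ` agrees with a coboundary, and a
system of linear equations over a field is solvable once its finite subsystems are
(`mem_twoCoboundaries_of_finite`). So `σ` is a coboundary (`mem_twoCoboundaries_of_tendsto`).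

The vector state at `δ₁` is a trace on the reduced twisted group C*-algebras
(`IsNormalizedMultiplier.vectorState_mul_comm`), so a normalized cocycle with nonzero class yields
the stated witnesses. The two statements about stability follow because each class has a
normalized representative, bounded if the original cocycle is (`exists_normalized`).
-/

/-! ### The trace of the logarithm -/

section TraceLog

variable {A : Type*} [NormedRing A] [NormedAlgebra ℂ A]

/-- `τ(log a)` for `‖1 - a‖ < 1`, defined by applying `τ` to the terms of the power series
`log a = -∑ (1 - a)ᵏ⁺¹ / (k + 1)`. -/
noncomputable def traceLog (τ : A →L[ℂ] ℂ) (a : A) : ℂ :=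
  ∑' k : ℕ, -(τ ((1 - a) ^ (k + 1)) / ((k : ℂ) + 1))

theorem norm_pow_mul_le_pow_norm_mul {R : Type*} [NormedRing R] (x v : R) (k : ℕ) :
    ‖x ^ k * v‖ ≤ ‖x‖ ^ k * ‖v‖ := by
  induction k with
  | zero => simp
  | succ k ih =>
    rw [pow_succ', mul_assoc, pow_succ', mul_assoc]
    exact (norm_mul_le _ _).trans (mul_le_mul_of_nonneg_left ih (norm_nonneg _))

/-- Under a trace the noncommutative derivative of `a ↦ (1 - a)ᵏ⁺¹` takes its commutative form. -/
theorem hasFDerivAt_traceLog_term {τ : A →L[ℂ] ℂ} (hτ : ∀ a b, τ (a * b) = τ (b * a)) (k : ℕ)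
    (a : A) :
    HasFDerivAt (fun x : A => -(τ ((1 - x) ^ (k + 1)) / ((k : ℂ) + 1)))
      (τ.comp (ContinuousLinearMap.mul ℂ A ((1 - a) ^ k))) a := by
  have h1 : HasFDerivAt (fun x : A => 1 - x) (-ContinuousLinearMap.id ℂ A) a :=
    (hasFDerivAt_id a).const_sub 1
  have h2 := ((τ.hasFDerivAt.comp a (h1.fun_pow' (k + 1))).const_smul (((k : ℂ) + 1)⁻¹)).neg
  have h3 : (fun x : A => -(τ ((1 - x) ^ (k + 1)) / ((k : ℂ) + 1))) =
      -(((k : ℂ) + 1)⁻¹ • (τ ∘ fun x : A => (1 - x) ^ (k + 1))) := by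
    funext x
    simp [div_eq_inv_mul]
  rw [h3]
  refine h2.congr_fderiv ?_
  ext v
  have hk : (k : ℂ) + 1 ≠ 0 := Nat.cast_add_one_ne_zero k
  have hterm : ∀ i ∈ Finset.range (k + 1),
      τ ((1 - a) ^ (k - i) * v * (1 - a) ^ i) = τ ((1 - a) ^ k * v) := by
    intro i hi
    rw [hτ, ← mul_assoc, ← pow_add, Nat.add_sub_cancel' (Nat.lt_succ_iff.1 (Finset.mem_range.1 hi))]
  simp only [neg_apply, smul_apply,
    ContinuousLinearMap.comp_apply, sum_apply, map_sum, Nat.pred_succ,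
    ContinuousLinearMap.id_apply, smul_neg, map_neg, Finset.sum_neg_distrib, smul_eq_mul,
    MulOpposite.smul_eq_mul_unop, MulOpposite.unop_op, ContinuousLinearMap.mul_apply']
  rw [Finset.sum_congr rfl hterm]
  simp [hk]

@[simp] theorem traceLog_one (τ : A →L[ℂ] ℂ) : traceLog τ 1 = 0 := by
  simp [traceLog]

theorem traceLog_conj {τ : A →L[ℂ] ℂ} (hτ : ∀ a b, τ (a * b) = τ (b * a)) (u : Aˣ) (a : A) :
    traceLog τ (u * a * ↑u⁻¹) = traceLog τ a := by
  have h : (1 : A) - u * a * ↑u⁻¹ = u * (1 - a) * ↑u⁻¹ := by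
    rw [mul_sub, sub_mul, mul_one, Units.mul_inv]
  have hpow : ∀ k, τ ((1 - u * a * ↑u⁻¹) ^ k) = τ ((1 - a) ^ k) := by
    intro k
    rw [h, Units.conj_pow, hτ, ← mul_assoc, Units.inv_mul, one_mul]
  simp only [traceLog, hpow]

theorem traceLog_algebraMap (τ : A →L[ℂ] ℂ) {z : ℂ} (hz : ‖1 - z‖ < 1) :
    traceLog τ (algebraMap ℂ A z) = Complex.log z * τ 1 := by
  have h1 := (hasSum_nat_add_iff' 1).2 (Complex.hasSum_taylorSeries_neg_log hz)
  have h2 := (h1.neg).mul_right (τ 1)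
  simp only [Finset.sum_range_one, Nat.cast_zero, div_zero, sub_zero, neg_neg,
    sub_sub_cancel] at h2
  rw [← h2.tsum_eq, traceLog]
  refine tsum_congr fun k => ?_
  have : (1 : A) - algebraMap ℂ A z = algebraMap ℂ A (1 - z) := by simp
  rw [this, ← map_pow, Algebra.algebraMap_eq_smul_one, map_smul, smul_eq_mul]
  push_cast
  ring

variable [CompleteSpace A]

/-- The derivative of `a ↦ τ(log a)` at `a` in the direction `a * v` is `τ(v)`. -/
theorem hasFDerivAt_traceLog {τ : A →L[ℂ] ℂ} (hτ : ∀ a b, τ (a * b) = τ (b * a)) {a : A}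
    (ha : ‖1 - a‖ < 1) :
    ∃ D : A →L[ℂ] ℂ, HasFDerivAt (traceLog τ) D a ∧ ∀ v, D (a * v) = τ v := by
  obtain ⟨r, har, hr⟩ := exists_between ha
  have hr0 : 0 ≤ r := (norm_nonneg _).trans har.le
  have hmem : ∀ {x : A}, x ∈ Metric.ball (1 : A) r ↔ ‖1 - x‖ < r := by
    intro x
    rw [mem_ball_iff_norm, norm_sub_rev]
  have hbound : ∀ (k : ℕ) (x : A), x ∈ Metric.ball (1 : A) r →
      ‖τ.comp (ContinuousLinearMap.mul ℂ A ((1 - x) ^ k))‖ ≤ ‖τ‖ * r ^ k := by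
    intro k x hx
    refine ContinuousLinearMap.opNorm_le_bound _ (by positivity) fun v => ?_
    rw [mul_assoc]
    refine (τ.le_opNorm _).trans (mul_le_mul_of_nonneg_left ?_ (norm_nonneg _))
    refine (norm_pow_mul_le_pow_norm_mul _ _ _).trans
      (mul_le_mul_of_nonneg_right ?_ (norm_nonneg _))
    exact pow_le_pow_left₀ (norm_nonneg _) (hmem.1 hx).le k
  have hu : Summable fun k : ℕ => ‖τ‖ * r ^ k := (summable_geometric_of_lt_one hr0 hr).mul_left _
  refine ⟨_, hasFDerivAt_tsum_of_isPreconnected hu Metric.isOpen_ball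
    (convex_ball (1 : A) r).isPreconnected (fun k x _ => hasFDerivAt_traceLog_term hτ k x) hbound
    (x₀ := 1) (hmem.2 (by simpa using lt_of_le_of_lt (norm_nonneg _) har)) (by simp)
    (hmem.2 har), fun v => ?_⟩
  have hs : Summable fun k : ℕ => τ.comp (ContinuousLinearMap.mul ℂ A ((1 - a) ^ k)) :=
    Summable.of_norm_bounded hu fun k => hbound k a (hmem.2 har)
  have h1 := hs.hasSum.mapL (ContinuousLinearMap.apply ℂ ℂ (a * v))
  have h2 := (((hasSum_geom_series_inverse (1 - a) ha).mul_right (a * v)).mapL τ)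
  have h3 : Ring.inverse (1 - (1 - a)) * (a * v) = v := by
    have hu : IsUnit (1 - (1 - a)) := isUnit_one_sub_of_norm_lt_one ha
    rw [sub_sub_cancel] at hu ⊢
    rw [← mul_assoc, Ring.inverse_mul_cancel _ hu, one_mul]
  rw [h3] at h2
  exact h1.unique h2

/-- The trace of the logarithm turns products of elements close to `1` into sums: for fixed `b` the
function `a ↦ τ(log(ab)) - τ(log a)` has zero derivative. -/
theorem traceLog_mul {τ : A →L[ℂ] ℂ} (hτ : ∀ a b, τ (a * b) = τ (b * a)) {a b : A}
    (ha : ‖1 - a‖ < 1 / 4) (hb : ‖1 - b‖ < 1 / 4) :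
    traceLog τ (a * b) = traceLog τ a + traceLog τ b := by
  have hmem : ∀ {x : A}, x ∈ Metric.ball (1 : A) (1 / 4) ↔ ‖1 - x‖ < 1 / 4 := by
    intro x
    rw [mem_ball_iff_norm, norm_sub_rev]
  -- The radius `1 / 4` keeps the products inside the disc of convergence of the logarithm.
  have hmul : ∀ x : A, ‖1 - x‖ < 1 / 4 → ‖1 - x * b‖ < 1 := by
    intro x hx
    have h : 1 - x * b = (1 - x) + (1 - b) - (1 - x) * (1 - b) := by noncomm_ring
    rw [h]
    have h1 := norm_sub_le ((1 - x) + (1 - b)) ((1 - x) * (1 - b))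
    have h2 := norm_add_le (1 - x) (1 - b)
    have h3 := norm_mul_le (1 - x) (1 - b)
    have h4 : ‖1 - x‖ * ‖1 - b‖ ≤ 1 / 4 * (1 / 4) :=
      mul_le_mul hx.le hb.le (norm_nonneg _) (by norm_num)
    linarith
  have hder : ∀ x ∈ Metric.ball (1 : A) (1 / 4),
      HasFDerivAt (fun x => traceLog τ (x * b) - traceLog τ x) (0 : A →L[ℂ] ℂ) x := by
    intro x hx
    have hx := hmem.1 hx
    obtain ⟨D, hD, hDv⟩ := hasFDerivAt_traceLog hτ (hmul x hx)
    obtain ⟨E, hE, hEv⟩ := hasFDerivAt_traceLog hτ (hx.trans (by norm_num))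
    have hR : HasFDerivAt (fun y : A => y * b) ((ContinuousLinearMap.mul ℂ A).flip b) x :=
      ((ContinuousLinearMap.mul ℂ A).flip b).hasFDerivAt
    refine ((hD.comp x hR).sub hE).congr_fderiv ?_
    ext w
    obtain ⟨c, hc⟩ : ∃ c, x * c = 1 := by
      have hu := isUnit_one_sub_of_norm_lt_one (hx.trans (by norm_num : (1 / 4 : ℝ) < 1))
      rw [sub_sub_cancel] at hu
      exact hu.exists_right_inv
    obtain ⟨d, hbd, -⟩ : ∃ d, b * d = 1 ∧ d * b = 1 := by
      have hu := isUnit_one_sub_of_norm_lt_one (hb.trans (by norm_num : (1 / 4 : ℝ) < 1))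
      rw [sub_sub_cancel] at hu
      exact isUnit_iff_exists.1 hu
    -- `D v = τ((xb)⁻¹v)` and `E v = τ(x⁻¹v)`, with `c = x⁻¹` and `d = b⁻¹`.
    have h1 : D (w * b) = τ (c * w) := by
      have : w * b = x * b * (d * (c * w) * b) := by
        rw [← mul_assoc, ← mul_assoc, mul_assoc x b d, hbd, mul_one, ← mul_assoc, hc, one_mul]
      rw [this, hDv, mul_assoc, hτ, mul_assoc, hbd, mul_one]
    have h2 : E w = τ (c * w) := by
      rw [← hEv (c * w), ← mul_assoc, hc, one_mul]
    simp [h1, h2]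
  have hconst := Metric.isOpen_ball.is_const_of_fderiv_eq_zero (𝕜 := ℂ)
    (convex_ball (1 : A) (1 / 4)).isPreconnected
    (fun x hx => (hder x hx).differentiableAt.differentiableWithinAt)
    (fun x hx => (hder x hx).fderiv) (hmem.2 ha) (Metric.mem_ball_self (by norm_num))
  simp only [one_mul, traceLog_one, sub_zero] at hconst
  rw [← hconst]
  ring

end TraceLog

/-! ### Coboundaries and finite systems of equations -/

section Coboundaries

variable {Γ : Type u} [Group Γ]

/-- A system of linear equations over a field is solvable as soon as each finite subsystem is; here
the equations are `∂γ(a, b) = σ(a, b)` in the unknown function `γ`. -/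
theorem mem_twoCoboundaries_of_finite {σ : Γ → Γ → ℝ}
    (h : ∀ F : Finset (Γ × Γ), ∃ γ : Γ → ℝ, ∀ p ∈ F, σ p.1 p.2 = coboundaryMap Γ γ p.1 p.2) :
    σ ∈ twoCoboundaries Γ := by
  let row : Γ × Γ → (Γ →₀ ℝ) := fun p =>
    Finsupp.single p.1 1 - Finsupp.single (p.1 * p.2) 1 + Finsupp.single p.2 1
  let f : (Γ × Γ →₀ ℝ) →ₗ[ℝ] (Γ →₀ ℝ) := Finsupp.linearCombination ℝ row
  let g : (Γ × Γ →₀ ℝ) →ₗ[ℝ] ℝ := Finsupp.linearCombination ℝ fun p => σ p.1 p.2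
  have hrow : ∀ (γ : Γ → ℝ) (p : Γ × Γ),
      Finsupp.linearCombination ℝ γ (row p) = coboundaryMap Γ γ p.1 p.2 := by
    intro γ p
    simp [row, coboundaryMap]
  -- `σ` satisfies each finite linear relation between the left-hand sides of the equations.
  have hg : g ∈ f.ker.dualAnnihilator := by
    rw [Submodule.mem_dualAnnihilator]
    intro c hc
    obtain ⟨γ, hγ⟩ := h c.support
    have h1 : g c = Finsupp.linearCombination ℝ γ (f c) := by
      simp only [f, g, Finsupp.linearCombination_apply, Finsupp.sum, map_sum, map_smul]
      refine Finset.sum_congr rfl fun p hp => ?_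
      rw [hγ p hp, ← hrow, Finsupp.linearCombination_apply]
      rfl
    rw [h1, LinearMap.mem_ker.1 hc, map_zero]
  rw [← LinearMap.range_dualMap_eq_dualAnnihilator_ker] at hg
  obtain ⟨φ, hφ⟩ := hg
  refine ⟨fun a => φ (Finsupp.single a 1), ?_⟩
  funext a b
  have h1 := LinearMap.congr_fun hφ (Finsupp.single (a, b) 1)
  simp only [LinearMap.dualMap_apply, f, g, Finsupp.linearCombination_single, one_smul, row,
    map_add, map_sub] at h1
  exact h1

theorem cohomologyClass_eq_zero_iff (σ : twoCocycles Γ) :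
    cohomologyClass Γ σ = 0 ↔ σ.1 ∈ twoCoboundaries Γ := by
  rw [cohomologyClass, Submodule.mkQ_apply, Submodule.Quotient.mk_eq_zero]
  rfl

end Coboundaries

/-! ### Projective representations far from representations -/

section Obstruction

/-- The elements `rs`, `rt`, `rst` stand for the values at `s`, `t`, `st` of a projective unitary
representation `ρ`, with multiplier `exp(iθ)` at `(s, t)`, and `ps`, `pt`, `pst` for those of a
homomorphism `π` close to `ρ`. With `x(s) = π(s)ρ(s)*` one has
`ρ(s)* x(st) ρ(s) = exp(iθ) · ρ(s)* x(s) ρ(s) · x(t)`, and the trace of the logarithm turns this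
product into a sum. -/
theorem traceLog_perturbation {B : Type v} [CStarAlgebra B] {τ : B →L[ℂ] ℂ} (hτ1 : τ 1 = 1)
    (hτ : ∀ a b, τ (a * b) = τ (b * a)) {θ : ℝ} (hθ : |θ| < 1 / 10)
    {rs rt rst : unitary B} (hr : (rs : B) * rt = Complex.exp (θ * Complex.I) • (rst : B))
    {ps pt pst : B} (hp : ps * pt = pst)
    (hs : ‖(rs : B) - ps‖ < 1 / 10) (ht : ‖(rt : B) - pt‖ < 1 / 10) :
    traceLog τ (pst * star (rst : B)) =
      θ * Complex.I + (traceLog τ (ps * star (rs : B)) + traceLog τ (pt * star (rt : B))) := by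
  set z : ℂ := Complex.exp (θ * Complex.I) with hz
  have hznorm : ‖z‖ = 1 := by rw [hz, Complex.norm_exp_ofReal_mul_I]
  have hz1 : ‖1 - z‖ ≤ |θ| := by
    rw [norm_sub_rev, hz, mul_comm]
    exact Real.norm_exp_I_mul_ofReal_sub_one_le
  have hdist : ∀ (u : unitary B) (p : B), ‖1 - p * star (u : B)‖ = ‖(u : B) - p‖ := by
    intro u p
    have : 1 - p * star (u : B) = ((u : B) - p) * star (u : B) := by
      rw [sub_mul, Unitary.mul_star_self_of_mem u.2]
    rw [this]
    exact CStarRing.norm_mul_coe_unitary _ (star u)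
  let u : Bˣ := ⟨star (rs : B), rs, Unitary.coe_star_mul_self rs, Unitary.coe_mul_star_self rs⟩
  have hu : ∀ a : B, (u : B) * a * ↑u⁻¹ = star (rs : B) * a * rs := by
    intro a
    rfl
  have key : (u : B) * (pst * star (rst : B)) * ↑u⁻¹ =
      algebraMap ℂ B z * ((u : B) * (ps * star (rs : B)) * ↑u⁻¹ * (pt * star (rt : B))) := by
    have h1 : star (rst : B) = z • (star (rt : B) * star (rs : B)) := by
      rw [← star_mul, hr, star_smul, smul_smul, Complex.star_def, Complex.mul_conj,
        Complex.normSq_eq_norm_sq, hznorm]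
      simp
    rw [hu, hu, ← hp, h1, ← Algebra.smul_def]
    have e1 : star (rs : B) * (ps * star (rs : B)) * rs = star (rs : B) * ps := by
      rw [mul_assoc, mul_assoc, Unitary.star_mul_self_of_mem rs.2, mul_one]
    have e2 : (star (rt : B) * star (rs : B)) * rs = star (rt : B) := by
      rw [mul_assoc, Unitary.star_mul_self_of_mem rs.2, mul_one]
    rw [e1, mul_smul_comm, mul_smul_comm, smul_mul_assoc, mul_assoc (star (rs : B)), mul_assoc,
      e2]
    simp only [mul_assoc]
  have hx : ‖1 - (u : B) * (ps * star (rs : B)) * ↑u⁻¹‖ < 1 / 10 := by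
    have e1 : (u : B) * (ps * star (rs : B)) * ↑u⁻¹ = star (rs : B) * ps := by
      rw [hu, mul_assoc, mul_assoc, Unitary.star_mul_self_of_mem rs.2, mul_one]
    have e2 : 1 - star (rs : B) * ps = star (rs : B) * (rs - ps) := by
      rw [mul_sub, Unitary.star_mul_self_of_mem rs.2]
    rw [e1, e2]
    exact (CStarRing.norm_coe_unitary_mul (star rs) _).trans_lt hs
  have hy : ‖1 - pt * star (rt : B)‖ < 1 / 10 := by rwa [hdist]
  generalize hX : (u : B) * (ps * star (rs : B)) * ↑u⁻¹ = X at key hx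
  generalize pt * star (rt : B) = Y at key hy
  have hXY : ‖1 - X * Y‖ < 1 / 4 := by
    have h : 1 - X * Y = (1 - X) + (1 - Y) - (1 - X) * (1 - Y) := by noncomm_ring
    rw [h]
    have h1 := norm_sub_le ((1 - X) + (1 - Y)) ((1 - X) * (1 - Y))
    have h2 := norm_add_le (1 - X) (1 - Y)
    have h3 := norm_mul_le (1 - X) (1 - Y)
    have h4 : ‖1 - X‖ * ‖1 - Y‖ ≤ 1 / 10 * (1 / 10) :=
      mul_le_mul hx.le hy.le (norm_nonneg _) (by norm_num)
    linarith
  have hzB : ‖(1 : B) - algebraMap ℂ B z‖ < 1 / 4 := by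
    have : (1 : B) - algebraMap ℂ B z = algebraMap ℂ B (1 - z) := by simp
    rw [this]
    nontriviality B
    rw [norm_algebraMap']
    linarith
  rw [← traceLog_conj hτ u (pst * star (rst : B)), key, traceLog_mul hτ hzB hXY,
    traceLog_mul hτ (hx.trans (by norm_num)) (hy.trans (by norm_num)), ← hX, traceLog_conj hτ,
    traceLog_algebraMap τ (hz1.trans_lt (hθ.trans (by norm_num))), hτ1, mul_one, hz,
    Complex.log_exp]
  · have := Real.pi_gt_three
    have := (abs_lt.1 hθ).1
    simp only [Complex.mul_im, Complex.ofReal_im, Complex.ofReal_re, Complex.I_im, Complex.I_re]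
    linarith
  · have := Real.pi_gt_three
    have := (abs_lt.1 hθ).2
    simp only [Complex.mul_im, Complex.ofReal_im, Complex.ofReal_re, Complex.I_im, Complex.I_re]
    linarith

theorem tendsto_const_div_nat_add_one (c : ℝ) :
    Tendsto (fun n : ℕ => c / ((n : ℝ) + 1)) atTop (𝓝 0) := by
  simpa [Function.comp_def] using
    (tendsto_const_div_atTop_nhds_zero_nat c).comp (tendsto_add_atTop_nat 1)

/-- If projective representations with multipliers `exp(2πiσ/(n + 1))` in tracial C*-algebras are
asymptotically close to representations by invertible elements, then `σ` is a coboundary. -/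
theorem mem_twoCoboundaries_of_tendsto {Γ : Type u} [Group Γ] {B : ℕ → Type v}
    [∀ n, CStarAlgebra (B n)] (τ : ∀ n, B n →L[ℂ] ℂ) (hτ1 : ∀ n, τ n 1 = 1)
    (hτ : ∀ n a b, τ n (a * b) = τ n (b * a)) {σ : Γ → Γ → ℝ} (ρ : ∀ n, Γ → unitary (B n))
    (hρ : ∀ n s t, (ρ n s : B n) * ρ n t =
      Complex.exp (2 * Real.pi * Complex.I * (σ s t : ℂ) / ((n : ℂ) + 1)) • (ρ n (s * t) : B n))
    (π : ∀ n, Γ →* (B n)ˣ)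
    (h : ∀ s, Tendsto (fun n => ‖(ρ n s : B n) - (π n s : B n)‖) atTop (𝓝 0)) :
    σ ∈ twoCoboundaries Γ := by
  let L : ℕ → Γ → ℝ := fun n s => (traceLog (τ n) ((π n s : B n) * star (ρ n s : B n))).im
  have hpair : ∀ p : Γ × Γ, ∀ᶠ n : ℕ in atTop, σ p.1 p.2 =
      coboundaryMap Γ (fun a => -(((n : ℝ) + 1) / (2 * Real.pi)) * L n a) p.1 p.2 := by
    rintro ⟨s, t⟩
    have hθ : Tendsto (fun n : ℕ => |2 * Real.pi * σ s t / ((n : ℝ) + 1)|) atTop (𝓝 0) := by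
      simpa using (tendsto_const_div_nat_add_one (2 * Real.pi * σ s t)).abs
    have hpos : (0 : ℝ) < 1 / 10 := by norm_num
    filter_upwards [hθ.eventually_lt_const hpos, (h s).eventually_lt_const hpos,
      (h t).eventually_lt_const hpos] with n h1 h2 h3
    have hr : (ρ n s : B n) * ρ n t =
        Complex.exp (((2 * Real.pi * σ s t / ((n : ℝ) + 1) : ℝ) : ℂ) * Complex.I) •
          (ρ n (s * t) : B n) := by
      rw [hρ]
      congr 2
      push_cast
      ring
    have hp : (π n s : B n) * π n t = π n (s * t) := by rw [map_mul, Units.val_mul]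
    have := congrArg Complex.im (traceLog_perturbation (hτ1 n) (hτ n) h1 hr hp h2 h3)
    simp only [Complex.add_im, Complex.mul_im, Complex.ofReal_re, Complex.ofReal_im, Complex.I_re,
      Complex.I_im, mul_one, mul_zero, add_zero] at this
    have hn : (n : ℝ) + 1 ≠ 0 := Nat.cast_add_one_ne_zero n
    have hpi := Real.pi_ne_zero
    simp only [coboundaryMap, LinearMap.coe_mk, AddHom.coe_mk, L, this]
    field_simp
    ring
  refine mem_twoCoboundaries_of_finite fun F => ?_
  obtain ⟨n, hn⟩ := ((eventually_all_finset F).2 fun p _ => hpair p).exists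
  exact ⟨_, hn⟩

end Obstruction

noncomputable section

/-! ### The reduced twisted group C*-algebra is separable and tracial -/

section TwistedAlgebra

variable {Γ : Type u} [Group Γ]

/-- A normalized 2-cocycle with values in the unit circle. -/
structure IsNormalizedMultiplier (ω : Γ → Γ → Circle) : Prop where
  cocycle : ∀ a b c, ω a b * ω (a * b) c = ω a (b * c) * ω b c
  apply_one : ∀ a, ω a 1 = 1
  one_apply : ∀ a, ω 1 a = 1

theorem twistedUnitary_apply (ω : Γ → Γ → Circle) (s : Γ) (f : EllTwo Γ) (r : Γ) :
    (twistedUnitary ω s : EllTwo Γ →L[ℂ] EllTwo Γ) f r = (ω s (s⁻¹ * r) : ℂ) * f (s⁻¹ * r) :=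
  rfl

namespace IsNormalizedMultiplier

variable {ω : Γ → Γ → Circle}

theorem apply_inv_comm (hω : IsNormalizedMultiplier ω) (s : Γ) : ω s s⁻¹ = ω s⁻¹ s := by
  simpa [hω.apply_one, hω.one_apply] using hω.cocycle s s⁻¹ s

theorem twistedUnitary_one (hω : IsNormalizedMultiplier ω) :
    (twistedUnitary ω 1 : EllTwo Γ →L[ℂ] EllTwo Γ) = 1 := by
  ext f r
  rw [twistedUnitary_apply, hω.one_apply]
  simp

theorem twistedUnitary_mul (hω : IsNormalizedMultiplier ω) (s t : Γ) :
    (twistedUnitary ω s : EllTwo Γ →L[ℂ] EllTwo Γ) * twistedUnitary ω t =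
      (ω s t : ℂ) • (twistedUnitary ω (s * t) : EllTwo Γ →L[ℂ] EllTwo Γ) := by
  ext f r
  have h := hω.cocycle s t (t⁻¹ * (s⁻¹ * r))
  rw [mul_inv_cancel_left] at h
  have h' : (ω s t : ℂ) * ω (s * t) (t⁻¹ * (s⁻¹ * r)) =
      ω s (s⁻¹ * r) * ω t (t⁻¹ * (s⁻¹ * r)) := by
    rw [← Circle.coe_mul, h, Circle.coe_mul]
  change (ω s (s⁻¹ * r) : ℂ) * ((ω t (t⁻¹ * (s⁻¹ * r)) : ℂ) * f (t⁻¹ * (s⁻¹ * r))) =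
    (ω s t : ℂ) * ((ω (s * t) ((s * t)⁻¹ * r) : ℂ) * f ((s * t)⁻¹ * r))
  rw [mul_inv_rev, mul_assoc t⁻¹]
  linear_combination (-(f (t⁻¹ * (s⁻¹ * r)) : ℂ)) * h'

theorem star_twistedUnitary (hω : IsNormalizedMultiplier ω) (s : Γ) :
    star (twistedUnitary ω s : EllTwo Γ →L[ℂ] EllTwo Γ) =
      ((ω s⁻¹ s)⁻¹ : Circle) • (twistedUnitary ω s⁻¹ : EllTwo Γ →L[ℂ] EllTwo Γ) := by
  have h := hω.twistedUnitary_mul s⁻¹ s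
  rw [inv_mul_cancel, hω.twistedUnitary_one] at h
  have h2 := congrArg (· * star (twistedUnitary ω s : EllTwo Γ →L[ℂ] EllTwo Γ)) h
  simp only [mul_assoc, Unitary.mul_star_self_of_mem (twistedUnitary ω s).2, mul_one,
    smul_mul_assoc, one_mul] at h2
  rw [h2, Circle.smul_def, smul_smul, ← Circle.coe_mul, inv_mul_cancel, Circle.coe_one, one_smul]

/-- The twisted group algebra is already spanned by the operators `λ_ω(s)`. -/
theorem adjoin_eq_span (hω : IsNormalizedMultiplier ω) :
    ((StarAlgebra.adjoin ℂ
      (Set.range fun s => (twistedUnitary ω s : EllTwo Γ →L[ℂ] EllTwo Γ)) :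
        StarSubalgebra ℂ (EllTwo Γ →L[ℂ] EllTwo Γ)) : Set (EllTwo Γ →L[ℂ] EllTwo Γ)) =
      Submodule.span ℂ
        (Set.range fun s => (twistedUnitary ω s : EllTwo Γ →L[ℂ] EllTwo Γ)) := by
  set S := Set.range fun s => (twistedUnitary ω s : EllTwo Γ →L[ℂ] EllTwo Γ)
  have hmem : ∀ s, (twistedUnitary ω s : EllTwo Γ →L[ℂ] EllTwo Γ) ∈ Submodule.span ℂ S :=
    fun s => Submodule.subset_span ⟨s, rfl⟩
  refine Set.Subset.antisymm (fun x hx => ?_) (fun x hx => ?_)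
  · refine StarAlgebra.adjoin_induction (p := fun x _ => x ∈ Submodule.span ℂ S)
      (fun x hx => Submodule.subset_span hx) (fun r => ?_)
      (fun x y _ _ hx hy => add_mem hx hy) (fun x y _ _ hx hy => ?_) (fun x hx' hx => ?_) hx
    · rw [Algebra.algebraMap_eq_smul_one, ← hω.twistedUnitary_one]
      exact Submodule.smul_mem _ _ (hmem 1)
    · have hxy := Submodule.mul_mem_mul hx hy
      rw [Submodule.span_mul_span] at hxy
      refine (Submodule.span_le.2 ?_) hxy
      rintro _ ⟨_, ⟨s, rfl⟩, _, ⟨t, rfl⟩, rfl⟩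
      simp only [hω.twistedUnitary_mul]
      exact Submodule.smul_mem _ _ (hmem _)
    · clear hx'
      induction hx using Submodule.span_induction with
      | mem x hx =>
        obtain ⟨s, rfl⟩ := hx
        simp only [hω.star_twistedUnitary, Circle.smul_def]
        exact Submodule.smul_mem _ _ (hmem _)
      | zero => simp
      | add x y _ _ hx hy => rw [star_add]; exact add_mem hx hy
      | smul c x _ hx => rw [star_smul]; exact Submodule.smul_mem _ _ hx
  · exact (Submodule.span_le (p := Subalgebra.toSubmodule (StarAlgebra.adjoin ℂ S).toSubalgebra)).2
      (StarAlgebra.subset_adjoin ℂ S) hx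

theorem coe_reducedTwisted (hω : IsNormalizedMultiplier ω) :
    (reducedTwisted ω : Set (EllTwo Γ →L[ℂ] EllTwo Γ)) =
      closure (Submodule.span ℂ
        (Set.range fun s => (twistedUnitary ω s : EllTwo Γ →L[ℂ] EllTwo Γ))) := by
  rw [← hω.adjoin_eq_span]
  rfl

theorem separableSpace_reducedTwisted [Countable Γ] (hω : IsNormalizedMultiplier ω) :
    TopologicalSpace.SeparableSpace (reducedTwisted ω) := by
  have h : TopologicalSpace.IsSeparable
      (reducedTwisted ω : Set (EllTwo Γ →L[ℂ] EllTwo Γ)) := by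
    rw [hω.coe_reducedTwisted]
    exact ((Set.countable_range _).isSeparable.span).closure
  exact h.separableSpace

end IsNormalizedMultiplier

/-- The vector state `a ↦ ⟨δ₁, a δ₁⟩` of the bounded operators on `ℓ²(Γ)`. -/
def vectorState (Γ : Type u) [Group Γ] : (EllTwo Γ →L[ℂ] EllTwo Γ) →L[ℂ] ℂ :=
  open Classical in
  (innerSL ℂ (lp.single 2 (1 : Γ) (1 : ℂ) : EllTwo Γ)).comp
    (ContinuousLinearMap.apply ℂ (EllTwo Γ) (lp.single 2 (1 : Γ) (1 : ℂ) : EllTwo Γ))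

theorem vectorState_apply [DecidableEq Γ] (a : EllTwo Γ →L[ℂ] EllTwo Γ) :
    vectorState Γ a = inner ℂ (lp.single 2 (1 : Γ) (1 : ℂ) : EllTwo Γ)
      (a (lp.single 2 (1 : Γ) (1 : ℂ) : EllTwo Γ)) := by
  obtain rfl : ‹DecidableEq Γ› = fun a b => Classical.propDecidable (a = b) :=
    Subsingleton.elim _ _
  rfl

theorem vectorState_one : vectorState Γ 1 = 1 := by
  classical
  rw [vectorState_apply, lp.inner_single_left]
  simp

theorem vectorState_star_mul_self (a : EllTwo Γ →L[ℂ] EllTwo Γ) :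
    ∃ r : ℝ, 0 ≤ r ∧ vectorState Γ (star a * a) = (r : ℂ) := by
  classical
  refine ⟨‖a (lp.single 2 (1 : Γ) (1 : ℂ) : EllTwo Γ)‖ ^ 2, by positivity, ?_⟩
  rw [vectorState_apply, mul_apply_eq_comp, ContinuousLinearMap.star_eq_adjoint,
    ContinuousLinearMap.adjoint_inner_right, inner_self_eq_norm_sq_to_K]
  simp

theorem vectorState_twistedUnitary {ω : Γ → Γ → Circle} {s : Γ} (hs : s ≠ 1) :
    vectorState Γ (twistedUnitary ω s) = 0 := by
  classical
  rw [vectorState_apply, lp.inner_single_left, twistedUnitary_apply, lp.single_apply]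
  simp [hs]

theorem IsNormalizedMultiplier.vectorState_twistedUnitary_comm {ω : Γ → Γ → Circle}
    (hω : IsNormalizedMultiplier ω) (s t : Γ) :
    vectorState Γ ((twistedUnitary ω s : EllTwo Γ →L[ℂ] EllTwo Γ) * twistedUnitary ω t) =
      vectorState Γ ((twistedUnitary ω t : EllTwo Γ →L[ℂ] EllTwo Γ) * twistedUnitary ω s) := by
  rw [hω.twistedUnitary_mul, hω.twistedUnitary_mul, map_smul, map_smul]
  by_cases h : s * t = 1
  · obtain rfl := eq_inv_of_mul_eq_one_right h
    rw [mul_inv_cancel, inv_mul_cancel, hω.apply_inv_comm]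
  · rw [vectorState_twistedUnitary h, vectorState_twistedUnitary (mul_eq_one_comm.not.1 h)]
    simp

/-- The vector state is tracial on the twisted algebra: by linearity and continuity this
reduces to the generators, where it is the symmetry `ω(s, s⁻¹) = ω(s⁻¹, s)`. -/
theorem IsNormalizedMultiplier.vectorState_mul_comm {ω : Γ → Γ → Circle}
    (hω : IsNormalizedMultiplier ω) {a b : EllTwo Γ →L[ℂ] EllTwo Γ}
    (ha : a ∈ reducedTwisted ω) (hb : b ∈ reducedTwisted ω) :
    vectorState Γ (a * b) = vectorState Γ (b * a) := by
  have hext : ∀ y : EllTwo Γ →L[ℂ] EllTwo Γ,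
      (∀ s, vectorState Γ ((twistedUnitary ω s : EllTwo Γ →L[ℂ] EllTwo Γ) * y) =
        vectorState Γ (y * twistedUnitary ω s)) →
      ∀ x ∈ reducedTwisted ω, vectorState Γ (x * y) = vectorState Γ (y * x) := by
    intro y hy x hx
    rw [← SetLike.mem_coe, hω.coe_reducedTwisted] at hx
    refine closure_minimal (s := ((Submodule.span ℂ
        (Set.range fun s => (twistedUnitary ω s : EllTwo Γ →L[ℂ] EllTwo Γ)) :
          Submodule ℂ (EllTwo Γ →L[ℂ] EllTwo Γ)) : Set (EllTwo Γ →L[ℂ] EllTwo Γ)))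
      (t := {x | vectorState Γ (x * y) = vectorState Γ (y * x)}) (fun z hz => ?_)
      (isClosed_eq (by fun_prop) (by fun_prop)) hx
    induction hz using Submodule.span_induction with
    | mem z hz =>
      obtain ⟨s, rfl⟩ := hz
      exact hy s
    | zero => simp
    | add z w _ _ hz hw =>
      simp only [Set.mem_ofPred_eq] at hz hw ⊢
      rw [add_mul, mul_add, map_add, map_add, hz, hw]
    | smul c z _ hz =>
      simp only [Set.mem_ofPred_eq] at hz ⊢
      rw [smul_mul_assoc, mul_smul_comm, map_smul, map_smul, hz]
  exact hext b (fun s => (hext _ (fun t => hω.vectorState_twistedUnitary_comm t s) b hb).symm) a ha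

/-- The canonical trace `a ↦ ⟨δ₁, a δ₁⟩` of `C*_r(Γ, ω)`. -/
def canonicalTrace (ω : Γ → Γ → Circle) : reducedTwisted ω →L[ℂ] ℂ :=
  (vectorState Γ).comp
    (Subalgebra.toSubmodule (reducedTwisted ω).toSubalgebra).subtypeL

theorem IsNormalizedMultiplier.isTracialState_canonicalTrace {ω : Γ → Γ → Circle}
    (hω : IsNormalizedMultiplier ω) :
    IsTracialState (canonicalTrace ω : reducedTwisted ω →ₗ[ℂ] ℂ) where
  map_one := vectorState_one
  nonneg a := vectorState_star_mul_self (a : EllTwo Γ →L[ℂ] EllTwo Γ)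
  tracial a b := hω.vectorState_mul_comm a.2 b.2

theorem IsNormalizedMultiplier.isSeparableTracial {ω : Γ → Γ → Circle} [Countable Γ]
    (hω : IsNormalizedMultiplier ω) : IsSeparableTracial (reducedTwisted ω) :=
  ⟨hω.separableSpace_reducedTwisted, _, hω.isTracialState_canonicalTrace⟩

end TwistedAlgebra

end

/-! ### The witnesses -/

section Witnesses

variable {Γ : Type u} [Group Γ]

theorem isNormalizedMultiplier_expCocycle {σ : Γ → Γ → ℝ} (hσ : σ ∈ twoCocycles Γ)
    (h1 : ∀ a, σ a 1 = 0 ∧ σ 1 a = 0) (θ : ℝ) : IsNormalizedMultiplier (expCocycle θ σ) where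
  cocycle a b c := by
    have h : σ a b + σ (a * b) c = σ a (b * c) + σ b c := hσ a b c
    simp only [expCocycle, ← Circle.exp_add, ← mul_add, h]
  apply_one a := by simp [expCocycle, (h1 a).1]
  one_apply a := by simp [expCocycle, (h1 a).2]

theorem projectiveRep_one {σ : Γ → Γ → ℝ} (hσ : σ ∈ twoCocycles Γ)
    (h1 : ∀ a, σ a 1 = 0 ∧ σ 1 a = 0) (n : ℕ) : projectiveRep σ n 1 = 1 :=
  Subtype.ext (Subtype.ext (isNormalizedMultiplier_expCocycle hσ h1 _).twistedUnitary_one)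

theorem projectiveRep_mul {σ : Γ → Γ → ℝ} (hσ : σ ∈ twoCocycles Γ)
    (h1 : ∀ a, σ a 1 = 0 ∧ σ 1 a = 0) (n : ℕ) (s t : Γ) :
    (projectiveRep σ n s : twistedAlgebra σ n) * projectiveRep σ n t =
      Complex.exp (2 * Real.pi * Complex.I * (σ s t : ℂ) / ((n : ℂ) + 1)) •
        (projectiveRep σ n (s * t) : twistedAlgebra σ n) := by
  refine Subtype.ext
    (((isNormalizedMultiplier_expCocycle hσ h1 _).twistedUnitary_mul s t).trans ?_)
  have h : (expCocycle (1 / ((n : ℝ) + 1)) σ s t : ℂ) =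
      Complex.exp (2 * Real.pi * Complex.I * (σ s t : ℂ) / ((n : ℂ) + 1)) := by
    rw [expCocycle, Circle.coe_exp]
    congr 1
    push_cast
    ring
  rw [h]
  rfl

theorem norm_projectiveRep_sub_le {σ : Γ → Γ → ℝ} (hσ : σ ∈ twoCocycles Γ)
    (h1 : ∀ a, σ a 1 = 0 ∧ σ 1 a = 0) (n : ℕ) (s t : Γ) :
    ‖(projectiveRep σ n (s * t) : twistedAlgebra σ n) -
      (projectiveRep σ n s : twistedAlgebra σ n) * projectiveRep σ n t‖ ≤
      2 * Real.pi * |σ s t| / ((n : ℝ) + 1) := by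
  have hn : (0 : ℝ) < (n : ℝ) + 1 := by positivity
  have hu : ∀ u : unitary (twistedAlgebra σ n), ‖(u : twistedAlgebra σ n)‖ ≤ 1 := by
    intro u
    rcases subsingleton_or_nontrivial (twistedAlgebra σ n) with _ | _
    · rw [Subsingleton.elim (u : twistedAlgebra σ n) 0, norm_zero]
      exact zero_le_one
    exact (CStarRing.norm_of_mem_unitary u.2).le
  have h2 : ∀ (z : ℂ) (x : twistedAlgebra σ n), x - z • x = (1 - z) • x := by
    intro z x
    rw [sub_smul, one_smul]
  have h3 : 2 * Real.pi * Complex.I * (σ s t : ℂ) / ((n : ℂ) + 1) =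
      Complex.I * ((2 * Real.pi * σ s t / ((n : ℝ) + 1) : ℝ) : ℂ) := by
    push_cast
    ring
  rw [projectiveRep_mul hσ h1, h2, norm_smul, norm_sub_rev, h3]
  refine (mul_le_mul Real.norm_exp_I_mul_ofReal_sub_one_le (hu _) (norm_nonneg _)
    (norm_nonneg _)).trans ?_
  rw [mul_one, Real.norm_eq_abs, abs_div, abs_mul, abs_of_pos Real.two_pi_pos, abs_of_pos hn]

theorem isAsymptoticHom_projectiveRep {σ : Γ → Γ → ℝ} (hσ : σ ∈ twoCocycles Γ)
    (h1 : ∀ a, σ a 1 = 0 ∧ σ 1 a = 0) : IsAsymptoticHom (projectiveRep σ) := fun s t =>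
  squeeze_zero (fun _ => norm_nonneg _) (fun n => norm_projectiveRep_sub_le hσ h1 n s t)
    (tendsto_const_div_nat_add_one _)

theorem isUniformAsymptoticHom_projectiveRep {σ : Γ → Γ → ℝ} (hσ : σ ∈ twoCocycles Γ)
    (h1 : ∀ a, σ a 1 = 0 ∧ σ 1 a = 0) {C : ℝ} (hC : ∀ s t, |σ s t| ≤ C) :
    IsUniformAsymptoticHom (projectiveRep σ) := by
  have hC0 : 0 ≤ C := (abs_nonneg _).trans (hC 1 1)
  refine squeeze_zero (fun _ => Real.iSup_nonneg fun _ => norm_nonneg _)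
    (fun n => Real.iSup_le (fun p => ?_) (by positivity))
    (tendsto_const_div_nat_add_one (2 * Real.pi * C))
  refine (norm_projectiveRep_sub_le hσ h1 n p.1 p.2).trans ?_
  gcongr
  exact hC _ _

theorem mem_twoCoboundaries_of_projectiveRep {σ : Γ → Γ → ℝ} (hσ : σ ∈ twoCocycles Γ)
    (h1 : ∀ a, σ a 1 = 0 ∧ σ 1 a = 0) (π : ∀ n, Γ →* (twistedAlgebra σ n)ˣ)
    (h : ∀ s : Γ, Tendsto (fun n => ‖(projectiveRep σ n s : twistedAlgebra σ n) -
      (π n s : twistedAlgebra σ n)‖) atTop (𝓝 0)) : σ ∈ twoCoboundaries Γ := by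
  have htr := fun n : ℕ => (isNormalizedMultiplier_expCocycle hσ h1
    (1 / ((n : ℝ) + 1))).isTracialState_canonicalTrace
  exact mem_twoCoboundaries_of_tendsto (fun n => canonicalTrace _) (fun n => (htr n).map_one)
    (fun n => (htr n).tracial) (projectiveRep σ) (projectiveRep_mul hσ h1) π h

/-- Subtracting the coboundary of the constant `σ(1, 1)` normalizes a 2-cocycle. -/
theorem exists_normalized (σ : twoCocycles Γ) :
    ∃ σ' : twoCocycles Γ, (∀ a, σ'.1 a 1 = 0 ∧ σ'.1 1 a = 0) ∧
      cohomologyClass Γ σ' = cohomologyClass Γ σ ∧ ∀ a b, σ'.1 a b = σ.1 a b - σ.1 1 1 := by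
  have hσ : ∀ a b c, σ.1 a b + σ.1 (a * b) c = σ.1 a (b * c) + σ.1 b c := σ.2
  refine ⟨⟨fun a b => σ.1 a b - σ.1 1 1, fun a b c => ?_⟩, fun a => ⟨?_, ?_⟩, ?_, fun _ _ => rfl⟩
  · linarith [hσ a b c]
  · have := hσ a 1 1
    simp only [mul_one] at this
    simp only [sub_eq_zero]
    linarith
  · have := hσ 1 1 a
    simp only [one_mul] at this
    simp only [sub_eq_zero]
    linarith
  · rw [← sub_eq_zero, ← map_sub, cohomologyClass_eq_zero_iff]
    refine ⟨fun _ => -σ.1 1 1, ?_⟩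
    funext a b
    simp [coboundaryMap]

/-- Homomorphisms into the unitary group do no better than homomorphisms into the invertibles. -/
theorem not_exists_unitary_homs {σ : twoCocycles Γ} (h1 : ∀ a, σ.1 a 1 = 0 ∧ σ.1 1 a = 0)
    (h0 : cohomologyClass Γ σ ≠ 0) :
    ¬ ∃ π : ∀ n, Γ →* unitary (twistedAlgebra σ.1 n), ∀ s : Γ,
      Tendsto (fun n => ‖(projectiveRep σ.1 n s : twistedAlgebra σ.1 n) -
        (π n s : twistedAlgebra σ.1 n)‖) atTop (𝓝 0) := by
  rintro ⟨π, hπ⟩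
  exact h0 ((cohomologyClass_eq_zero_iff σ).2 (mem_twoCoboundaries_of_projectiveRep σ.2 h1
    (fun n => Unitary.toUnits.comp (π n)) hπ))

end Witnesses

/-- Nonvanishing of `H²(Γ, ℝ)` (resp. of the comparison map) obstructs local-to-local (resp.
uniform-to-local) stability. The last part says that the canonical projective representations
`ρ_m : Γ → U(C*_r(Γ, e^{2πiσ/m}))`, `m ≥ 1` (indexed here by `m = n + 1`), are witnesses, even
against homomorphisms into the groups of invertible elements. -/
theorem theorem1p2 (Γ : Type u) [Group Γ] [Countable Γ] :
    (Nontrivial (SecondCohomology Γ) →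
      ¬ IsLocalToLocalStable Γ (fun (A : Type u) [CStarAlgebra A] => IsSeparableTracial A)) ∧
    (comparisonMap Γ ≠ 0 →
      ¬ IsUniformToLocalStable Γ (fun (A : Type u) [CStarAlgebra A] => IsSeparableTracial A)) ∧
    (∀ σ : twoCocycles Γ, (∀ a : Γ, σ.1 a 1 = 0 ∧ σ.1 1 a = 0) → cohomologyClass Γ σ ≠ 0 →
      (∀ n, IsSeparableTracial (twistedAlgebra σ.1 n)) ∧
      (∀ n, projectiveRep σ.1 n 1 = 1) ∧
      (∀ (n : ℕ) (s t : Γ),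
        (projectiveRep σ.1 n s : twistedAlgebra σ.1 n) * (projectiveRep σ.1 n t) =
          Complex.exp (2 * Real.pi * Complex.I * (σ.1 s t : ℂ) / ((n : ℂ) + 1)) •
            (projectiveRep σ.1 n (s * t) : twistedAlgebra σ.1 n)) ∧
      IsAsymptoticHom (projectiveRep σ.1) ∧
      ((∃ C : ℝ, ∀ s t, |σ.1 s t| ≤ C) → IsUniformAsymptoticHom (projectiveRep σ.1)) ∧
      ¬ ∃ π : ∀ n, Γ →* (twistedAlgebra σ.1 n)ˣ, ∀ s : Γ,
        Tendsto (fun n => ‖(projectiveRep σ.1 n s : twistedAlgebra σ.1 n) -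
          (π n s : twistedAlgebra σ.1 n)‖) atTop (𝓝 0)) := by
  refine ⟨fun hne hstable => ?_, fun hJ hstable => ?_, fun σ h1 h0 => ?_⟩
  · obtain ⟨c, hc⟩ := exists_ne (0 : SecondCohomology Γ)
    obtain ⟨σ₀, rfl⟩ := Submodule.mkQ_surjective _ c
    obtain ⟨σ, h1, hcl, -⟩ := exists_normalized σ₀
    exact not_exists_unitary_homs h1 (hcl ▸ hc) (hstable _
      (fun n => (isNormalizedMultiplier_expCocycle σ.2 h1 _).isSeparableTracial)
      (projectiveRep σ.1) (projectiveRep_one σ.2 h1) (isAsymptoticHom_projectiveRep σ.2 h1))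
  · obtain ⟨c, hc⟩ : ∃ c, comparisonMap Γ c ≠ 0 := by
      by_contra! h
      exact hJ (LinearMap.ext h)
    obtain ⟨⟨σ₀, hσ₀, C, hC⟩, rfl⟩ := Submodule.mkQ_surjective _ c
    obtain ⟨σ, h1, hcl, hval⟩ := exists_normalized ⟨σ₀, hσ₀⟩
    have hb : ∀ s t, |σ.1 s t| ≤ C + C := fun s t => by
      rw [hval]
      exact (abs_sub _ _).trans (add_le_add (hC _ _) (hC _ _))
    have h0 : cohomologyClass Γ ⟨σ₀, hσ₀⟩ ≠ 0 := hc
    exact not_exists_unitary_homs h1 (hcl ▸ h0) (hstable _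
      (fun n => (isNormalizedMultiplier_expCocycle σ.2 h1 _).isSeparableTracial)
      (projectiveRep σ.1) (projectiveRep_one σ.2 h1)
      (isUniformAsymptoticHom_projectiveRep σ.2 h1 hb))
  · refine ⟨fun n => (isNormalizedMultiplier_expCocycle σ.2 h1 _).isSeparableTracial,
      projectiveRep_one σ.2 h1, projectiveRep_mul σ.2 h1, isAsymptoticHom_projectiveRep σ.2 h1,
      fun ⟨C, hC⟩ => isUniformAsymptoticHom_projectiveRep σ.2 h1 hC, ?_⟩
    rintro ⟨π, hπ⟩
    exact h0 ((cohomologyClass_eq_zero_iff σ).2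
      (mem_twoCoboundaries_of_projectiveRep σ.2 h1 π hπ))
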